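/- There is an absolute constant $C>0$ such that the following holds for all integers $\ell\ge 0$ and $n\ge 1$. Let $Z$ be a random matrix in $\mathbb R^{\ell\times \ell}$ that is almost surely (symmetric) positive semidefinite, let $\Sigma=\mathbb E Z$, and suppose that for some $\eta\ge 1$, for every real $p\ge 1$ and every $u\in\mathbb R^{\ell}$, $$\left(\mathbb E\left|u^{\mathsf T} Z u\right|^p\right)^{1/p}\le \eta\, p\,\|u\|_\Sigma^2,\qquad\text{where } \|u\|_\Sigma=\sqrt{u^{\mathsf T}\Sigma u}.$$ Let $Z_1,\dots,Z_n$ be i.i.d. copies of $Z$, let $\|\cdot\|_{\mathrm{op}}$ denote the operator norm with respect to the Euclidean norm, and let $r_{\mathrm{eff}}(\Sigma)=\operatorname{tr}(\Sigma)/\|\Sigma\|_{\mathrm{op}}$ be the effective rank of $\Sigma$ (set to $0$ if $\Sigma=0$). Then, for every $t\ge 0$, with probability at least $1-e^{-t}$, $$\left\|\frac1n\sum_{i=1}^n Z_i-\Sigma\right\|_{\mathrm{op}}\le C\,\eta\,\|\Sigma\|_{\mathrm{op}}\sqrt{\frac{2r_{\mathrm{eff}}(\Sigma)+t}{n}}\;\max\left\{1,\sqrt{\frac{r_{\mathrm{eff}}(\Sigma)+t/2}{n}}\right\}.$$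 -/

import Mathlib

open MeasureTheory ProbabilityTheory

open scoped Matrix ENNReal

noncomputable section

/-- The Borel (entrywise product) sigma-algebra on square real matrices. -/
instance matMeasurableSpace {l : ℕ} : MeasurableSpace (Matrix (Fin l) (Fin l) ℝ) :=
  inferInstanceAs (MeasurableSpace (Fin l → Fin l → ℝ))

/-- The spectral norm of a square real matrix: its operator norm as a map of Euclidean space. -/
def opNorm {l : ℕ} (A : Matrix (Fin l) (Fin l) ℝ) : ℝ :=
  ‖Matrix.toEuclideanCLM (n := Fin l) (𝕜 := ℝ) A‖

/-- The seminorm `‖u‖_M = √(uᵀ M u)` attached to a positive semidefinite matrix `M`. -/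
def matNorm {l : ℕ} (M : Matrix (Fin l) (Fin l) ℝ) (u : Fin l → ℝ) : ℝ :=
  Real.sqrt (u ⬝ᵥ (M *ᵥ u))

/-- The effective rank `tr M / ‖M‖_op` (with the value `0` at `M = 0`). -/
def effRank {l : ℕ} (M : Matrix (Fin l) (Fin l) ℝ) : ℝ :=
  M.trace / opNorm M

/-- The entrywise expectation of a random matrix. -/
def matMean {Ω : Type*} [MeasurableSpace Ω] {l : ℕ} (μ : Measure Ω)
    (Z : Ω → Matrix (Fin l) (Fin l) ℝ) : Matrix (Fin l) (Fin l) ℝ :=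
  Matrix.of fun i j => ∫ ω, Z ω i j ∂μ

end

/-! The proof is a PAC-Bayesian argument: the supremum over pairs of unit vectors is replaced by an
average over a Gaussian prior, at a cost proportional to the effective rank.

Write `s` for the operator norm of `S`, `r` for its effective rank, and `A = ∑ Zᵢ - n S`. For fixed
`x`, `y` whose quadratic forms under `S` are at most `6s`, the moment growth makes `xᵀ Z y`
sub-exponential. Hence for small `lam` the variable `exp (lam xᵀ A y - n b)` has mean at most 1,
with `b` of order `(lam η s)²` (`lintegral_exp_bilin_le`, `lintegral_exp_sum_le`). Integrating over
`x`, `y` drawn from an isotropic Gaussian of variance `v`, restricted to such vectors, gives a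
random variable `W` of mean at most 1, and Markov yields `W < exp t` outside an event of probability
at most `exp (-t)`.

On that event all unit `u`, `w` are handled at once: shifting the Gaussian to `u` costs a factor
`exp (-1/(2v))`, truncation costs `1/2`, and by symmetry the remaining linear exponent only helps
(`le_setLIntegral_exp_affine`). Doing this in both variables gives `lam uᵀ A w ≤ n b + 2 log 2 + 1/v
+ t` (`pacBayes_bilin`). With `v = s / tr S` the entropy term `1/v` is exactly `r`, and optimising
`lam` under the smallness constraint gives the two regimes of the maximum. -/

/-! ### Gaussian smoothing: shifts, truncation and symmetry -/

theorem gaussianReal_eq_withDensity_shift (m : ℝ) {v : NNReal} (hv : v ≠ 0) :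
    gaussianReal 0 v = (gaussianReal m v).withDensity
      (fun x => ENNReal.ofReal (Real.exp (-(m * x) / v + m ^ 2 / (2 * v)))) := by
  rw [gaussianReal_of_var_ne_zero _ hv, gaussianReal_of_var_ne_zero _ hv,
    ← withDensity_mul _ (measurable_gaussianPDF m v) (by fun_prop)]
  congr 1
  ext x
  have hv' : (v : ℝ) ≠ 0 := by exact_mod_cast hv
  simp only [gaussianPDF, Pi.mul_apply, gaussianPDFReal]
  rw [← ENNReal.ofReal_mul (by positivity), mul_assoc _ (Real.exp _) (Real.exp _), ← Real.exp_add]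
  congr 3
  field_simp
  ring

theorem pi_withDensity_eq {ι : Type*} [Fintype ι] {α : ι → Type*} [∀ i, MeasurableSpace (α i)]
    (μ : ∀ i, Measure (α i)) [∀ i, IsProbabilityMeasure (μ i)] (f : ∀ i, α i → ℝ≥0∞)
    (hf : ∀ i, Measurable (f i)) [∀ i, SigmaFinite ((μ i).withDensity (f i))] :
    Measure.pi (fun i => (μ i).withDensity (f i)) =
      (Measure.pi μ).withDensity (fun x => ∏ i, f i (x i)) := by
  refine Measure.pi_eq fun s hs => ?_
  rw [withDensity_apply _ (MeasurableSet.univ_pi hs), ← lintegral_indicator (MeasurableSet.univ_pi hs)]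
  have h1 : ∀ x : ∀ i, α i, (Set.univ.pi s).indicator (fun x => ∏ i, f i (x i)) x =
      ∏ i, (s i).indicator (f i) (x i) := by
    intro x
    by_cases hx : x ∈ Set.univ.pi s
    · rw [Set.indicator_of_mem hx]
      exact Finset.prod_congr rfl fun i _ => (Set.indicator_of_mem (hx i trivial) _).symm
    · rw [Set.indicator_of_notMem hx]
      obtain ⟨i, hi⟩ : ∃ i, x i ∉ s i := by simpa [Set.mem_pi] using hx
      exact (Finset.prod_eq_zero (Finset.mem_univ i) (Set.indicator_of_notMem hi _)).symm
  simp_rw [h1]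
  have hm : ∀ i, Measurable ((s i).indicator (f i)) := fun i => (hf i).indicator (hs i)
  rw [lintegral_prod_eq_prod_lintegral_of_indepFun Finset.univ
    (fun i (x : ∀ i, α i) => (s i).indicator (f i) (x i))
    (iIndepFun_pi (X := fun i => (s i).indicator (f i)) fun i => (hm i).aemeasurable)
    (fun i => (hm i).comp (measurable_pi_apply i))]
  refine Finset.prod_congr rfl fun i _ => ?_
  rw [withDensity_apply _ (hs i), ← lintegral_indicator (hs i)]
  exact (measurePreserving_eval μ i).lintegral_comp (hm i)

/-- The centred isotropic Gaussian measure on `ℝˡ` with variance `v` in each coordinate. -/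
noncomputable def isoGaussian (l : ℕ) (v : NNReal) : Measure (Fin l → ℝ) :=
  Measure.pi fun _ => gaussianReal 0 v

instance (l : ℕ) (v : NNReal) : IsProbabilityMeasure (isoGaussian l v) := by
  unfold isoGaussian; infer_instance

/-- Cameron–Martin formula, obtained coordinatewise from the ratio of two one-dimensional Gaussian
densities. -/
theorem lintegral_isoGaussian_shift {l : ℕ} {v : NNReal} (hv : v ≠ 0) (u : Fin l → ℝ)
    {F : (Fin l → ℝ) → ℝ≥0∞} (hF : Measurable F) :
    ∫⁻ x, F x ∂isoGaussian l v = ∫⁻ z, F (z + u) *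
      ENNReal.ofReal (Real.exp (-(u ⬝ᵥ z) / v - u ⬝ᵥ u / (2 * v))) ∂isoGaussian l v := by
  have h1 : isoGaussian l v = (Measure.pi fun i => gaussianReal (u i) v).withDensity
      (fun x => ∏ i, ENNReal.ofReal (Real.exp (-(u i * x i) / v + u i ^ 2 / (2 * v)))) := by
    have : ∀ i, SigmaFinite ((gaussianReal (u i) v).withDensity
      (fun x => ENNReal.ofReal (Real.exp (-(u i * x) / v + u i ^ 2 / (2 * v))))) := by
      intro i
      rw [← gaussianReal_eq_withDensity_shift (u i) hv]
      infer_instance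
    rw [← pi_withDensity_eq (fun i => gaussianReal (u i) v)
      (fun i x => ENNReal.ofReal (Real.exp (-(u i * x) / v + u i ^ 2 / (2 * v))))
      (fun i => by fun_prop)]
    unfold isoGaussian
    congr 1
    ext1 i
    exact gaussianReal_eq_withDensity_shift (u i) hv
  have h2 : (Measure.pi fun i => gaussianReal (u i) v) =
      (isoGaussian l v).map (fun z => z + u) := by
    have : ∀ i, (gaussianReal 0 v).map (fun x => x + u i) = gaussianReal (u i) v := fun i => by
      rw [gaussianReal_map_add_const, zero_add]
    simp_rw [← this]
    rw [← Measure.pi_map_pi (fun i => by fun_prop)]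
    rfl
  conv_lhs => rw [h1]
  rw [lintegral_withDensity_eq_lintegral_mul _ (by fun_prop) hF, h2,
    lintegral_map (by fun_prop) (by fun_prop)]
  refine lintegral_congr fun z => ?_
  rw [Pi.mul_apply, mul_comm, ← ENNReal.ofReal_prod_of_nonneg (fun i _ => (Real.exp_pos _).le),
    ← Real.exp_sum]
  congr 3
  simp only [dotProduct, Pi.add_apply, neg_div, Finset.sum_div, ← Finset.sum_neg_distrib,
    ← Finset.sum_sub_distrib]
  have hv' : (v : ℝ) ≠ 0 := by exact_mod_cast hv
  refine Finset.sum_congr rfl fun i _ => ?_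
  field_simp
  ring

theorem measurePreserving_neg_isoGaussian (l : ℕ) (v : NNReal) :
    MeasurePreserving (fun z : Fin l → ℝ => -z) (isoGaussian l v) (isoGaussian l v) := by
  refine ⟨by fun_prop, ?_⟩
  have h := Measure.pi_map_pi (μ := fun _ : Fin l => gaussianReal 0 v) (f := fun _ x => -x)
    (hμ := fun i => by rw [gaussianReal_map_neg]; infer_instance) (fun i => by fun_prop)
  simp only [gaussianReal_map_neg, neg_zero] at h
  exact h

theorem integral_mul_isoGaussian {l : ℕ} (v : NNReal) (i j : Fin l) :
    Integrable (fun z => z i * z j) (isoGaussian l v) ∧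
    ∫ z, z i * z j ∂isoGaussian l v = if i = j then (v : ℝ) else 0 := by
  have hmp : ∀ i, MeasurePreserving (Function.eval i) (isoGaussian l v) (gaussianReal 0 v) :=
    fun i => measurePreserving_eval _ i
  have hL : ∀ i, MemLp (fun z : Fin l → ℝ => z i) 2 (isoGaussian l v) := fun i =>
    (memLp_id_gaussianReal 2 (μ := 0) (v := v)).comp_measurePreserving (hmp i)
  refine ⟨(hL i).integrable_mul (hL j), ?_⟩
  have h0 : ∀ i, ∫ z, z i ∂isoGaussian l v = 0 := fun i => by
    have h := integral_map (μ := isoGaussian l v) (f := id) (hmp i).measurable.aemeasurable aestronglyMeasurable_id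
    rw [(hmp i).map_eq] at h
    exact h.symm.trans integral_id_gaussianReal
  split_ifs with hij
  · subst hij
    have h := integral_map (μ := isoGaussian l v) (φ := Function.eval i) (f := fun x : ℝ => x * x)
      (hmp i).measurable.aemeasurable
      (by fun_prop)
    rw [(hmp i).map_eq] at h
    refine h.symm.trans ?_
    rw [← variance_id_gaussianReal (μ := 0) (v := v),
      variance_of_integral_eq_zero (X := id) (by fun_prop) integral_id_gaussianReal]
    simp [sq]
  · have hind : iIndepFun (fun (i : Fin l) (z : Fin l → ℝ) => z i) (isoGaussian l v) :=
      iIndepFun_pi (X := fun _ => id) (fun i => by fun_prop)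
    have := (hind.indepFun hij).integral_mul_eq_mul_integral (hL i).1 (hL j).1
    simpa [h0] using this

theorem integral_quadForm_isoGaussian {l : ℕ} (v : NNReal) (S : Matrix (Fin l) (Fin l) ℝ) :
    Integrable (fun z => z ⬝ᵥ (S *ᵥ z)) (isoGaussian l v) ∧
    ∫ z, z ⬝ᵥ (S *ᵥ z) ∂isoGaussian l v = v * S.trace := by
  have h1 : ∀ z : Fin l → ℝ, z ⬝ᵥ (S *ᵥ z) = ∑ i, ∑ j, S i j * (z i * z j) := fun z => by
    simp only [dotProduct, Matrix.mulVec, Finset.mul_sum]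
    exact Finset.sum_congr rfl fun i _ => Finset.sum_congr rfl fun j _ => by ring
  simp_rw [h1]
  have hi : ∀ i j, Integrable (fun z : Fin l → ℝ => S i j * (z i * z j)) (isoGaussian l v) :=
    fun i j => (integral_mul_isoGaussian v i j).1.const_mul _
  refine ⟨integrable_finsetSum _ fun i _ => integrable_finsetSum _ fun j _ => hi i j, ?_⟩
  rw [integral_finsetSum _ fun i _ => integrable_finsetSum _ fun j _ => hi i j]
  simp_rw [integral_finsetSum _ fun j _ => hi _ j, integral_const_mul,
    (integral_mul_isoGaussian v _ _).2]
  simp [Matrix.trace, Finset.mul_sum, mul_comm]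

/-- Markov's inequality, since the quadratic form has mean `v * S.trace ≤ s`. -/
theorem half_le_isoGaussian_quadForm_le {l : ℕ} (v : NNReal) {S : Matrix (Fin l) (Fin l) ℝ}
    (hS : S.PosSemidef) {s : ℝ} (hs : 0 < s) (htr : v * S.trace ≤ s) :
    ENNReal.ofReal (1 / 2) ≤ isoGaussian l v {z | z ⬝ᵥ (S *ᵥ z) ≤ 2 * s} := by
  obtain ⟨hint, hval⟩ := integral_quadForm_isoGaussian v S
  have hnn : 0 ≤ᵐ[isoGaussian l v] fun z => z ⬝ᵥ (S *ᵥ z) :=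
    Filter.Eventually.of_forall fun z => by simpa using hS.dotProduct_mulVec_nonneg z
  have hmark := mul_meas_ge_le_integral_of_nonneg hnn hint (2 * s)
  have hmeas : MeasurableSet {z : Fin l → ℝ | z ⬝ᵥ (S *ᵥ z) ≤ 2 * s} :=
    measurableSet_le (by fun_prop) measurable_const
  have hsub : {z : Fin l → ℝ | z ⬝ᵥ (S *ᵥ z) ≤ 2 * s}ᶜ ⊆ {z | 2 * s ≤ z ⬝ᵥ (S *ᵥ z)} :=
    fun z hz => by
    simp only [Set.mem_compl_iff, Set.mem_ofPred_eq, not_le] at hz ⊢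
    exact hz.le
  have h2 : (isoGaussian l v).real {z | z ⬝ᵥ (S *ᵥ z) ≤ 2 * s}ᶜ ≤ 1 / 2 := by
    refine (measureReal_mono hsub).trans ?_
    rw [hval] at hmark
    nlinarith
  rw [probReal_compl_eq_one_sub hmeas] at h2
  rw [← ofReal_measureReal]
  exact ENNReal.ofReal_le_ofReal (by linarith)

/-- Averaging the integrand over `z` and `-z` turns it into a hyperbolic cosine, which is at least
1. -/
theorem le_lintegral_exp_linear {l : ℕ} (v : NNReal) {B : Set (Fin l → ℝ)} (hB : MeasurableSet B)
    (hneg : ∀ z, -z ∈ B ↔ z ∈ B) (a : Fin l → ℝ) :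
    isoGaussian l v B ≤ ∫⁻ z in B, ENNReal.ofReal (Real.exp (a ⬝ᵥ z)) ∂isoGaussian l v := by
  have hflip : ∫⁻ z in B, ENNReal.ofReal (Real.exp (-(a ⬝ᵥ z))) ∂isoGaussian l v =
      ∫⁻ z in B, ENNReal.ofReal (Real.exp (a ⬝ᵥ z)) ∂isoGaussian l v := by
    have h := (measurePreserving_neg_isoGaussian l v).setLIntegral_comp_preimage hB
      (f := fun z => ENNReal.ofReal (Real.exp (a ⬝ᵥ z))) (by fun_prop)
    have hpre : (fun z : Fin l → ℝ => -z) ⁻¹' B = B := by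
      ext z; exact hneg z
    rw [hpre] at h
    simpa using h
  have h2 : 2 * isoGaussian l v B ≤
      2 * ∫⁻ z in B, ENNReal.ofReal (Real.exp (a ⬝ᵥ z)) ∂isoGaussian l v := by
    conv_rhs => rw [two_mul]
    nth_rewrite 2 [← hflip]
    rw [← lintegral_add_left (by fun_prop), ← setLIntegral_const]
    refine lintegral_mono fun z => ?_
    rw [← ENNReal.ofReal_add (Real.exp_pos _).le (Real.exp_pos _).le]
    have : (2 : ℝ≥0∞) = ENNReal.ofReal 2 := by simp
    rw [this]
    refine ENNReal.ofReal_le_ofReal ?_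
    nlinarith [Real.add_one_le_exp (a ⬝ᵥ z), Real.add_one_le_exp (-(a ⬝ᵥ z))]
  exact (ENNReal.mul_le_mul_iff_right (by simp) (by simp)).1 h2

theorem quadForm_add_le {l : ℕ} {S : Matrix (Fin l) (Fin l) ℝ} (hS : S.PosSemidef)
    (x y : Fin l → ℝ) :
    (x + y) ⬝ᵥ (S *ᵥ (x + y)) ≤ 2 * (x ⬝ᵥ (S *ᵥ x)) + 2 * (y ⬝ᵥ (S *ᵥ y)) := by
  have h : 0 ≤ (x - y) ⬝ᵥ (S *ᵥ (x - y)) := by simpa using hS.dotProduct_mulVec_nonneg (x - y)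
  simp only [Matrix.mulVec_sub, Matrix.mulVec_add, dotProduct_sub, sub_dotProduct, dotProduct_add,
    add_dotProduct] at h ⊢
  linarith

/-- Gaussian smoothing lower bound: the variational inequality for a truncated Gaussian
posterior centred at `u`. -/
theorem le_setLIntegral_exp_affine {l : ℕ} {v : NNReal} (hv : v ≠ 0)
    {S : Matrix (Fin l) (Fin l) ℝ} (hS : S.PosSemidef) {s : ℝ} (hs : 0 < s)
    (htr : v * S.trace ≤ s) {u : Fin l → ℝ} (hu : u ⬝ᵥ u = 1) (huS : u ⬝ᵥ (S *ᵥ u) ≤ s)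
    (c : ℝ) (a : Fin l → ℝ) :
    ENNReal.ofReal (1 / 2 * Real.exp (-(1 / (2 * v))) * Real.exp (c + a ⬝ᵥ u)) ≤
      ∫⁻ x in {x | x ⬝ᵥ (S *ᵥ x) ≤ 6 * s}, ENNReal.ofReal (Real.exp (c + a ⬝ᵥ x))
        ∂isoGaussian l v := by
  have hG : MeasurableSet {x : Fin l → ℝ | x ⬝ᵥ (S *ᵥ x) ≤ 6 * s} :=
    measurableSet_le (by fun_prop) measurable_const
  set B : Set (Fin l → ℝ) := {z | z ⬝ᵥ (S *ᵥ z) ≤ 2 * s} with hBdef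
  have hB : MeasurableSet B := measurableSet_le (by fun_prop) measurable_const
  have hneg : ∀ z, -z ∈ B ↔ z ∈ B := fun z => by simp [hBdef, Matrix.mulVec_neg]
  rw [← lintegral_indicator hG, lintegral_isoGaussian_shift hv u
    (Measurable.indicator (by fun_prop) hG)]
  calc ENNReal.ofReal (1 / 2 * Real.exp (-(1 / (2 * v))) * Real.exp (c + a ⬝ᵥ u))
      = ENNReal.ofReal (Real.exp (-(1 / (2 * v))) * Real.exp (c + a ⬝ᵥ u)) *
          ENNReal.ofReal (1 / 2) := by
        rw [← ENNReal.ofReal_mul (by positivity)]; congr 1; ring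
    _ ≤ ENNReal.ofReal (Real.exp (-(1 / (2 * v))) * Real.exp (c + a ⬝ᵥ u)) *
          ∫⁻ z in B, ENNReal.ofReal (Real.exp ((a - (v : ℝ)⁻¹ • u) ⬝ᵥ z)) ∂isoGaussian l v := by
        gcongr
        exact (half_le_isoGaussian_quadForm_le v hS hs htr).trans
          (le_lintegral_exp_linear v hB hneg _)
    _ ≤ _ := by
        rw [← lintegral_const_mul _ (by fun_prop), ← lintegral_indicator hB]
        refine lintegral_mono fun z => ?_
        by_cases hz : z ∈ B
        -- The radius `6s` arises as `2 · 2s + 2 · s`, from `z ∈ B` and `huS`.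
        · have hzG : z + u ∈ {x : Fin l → ℝ | x ⬝ᵥ (S *ᵥ x) ≤ 6 * s} := by
            have h1 := quadForm_add_le hS z u
            have h2 : z ⬝ᵥ (S *ᵥ z) ≤ 2 * s := hz
            simp only [Set.mem_ofPred_eq]
            linarith
          rw [Set.indicator_of_mem hz, Set.indicator_of_mem hzG,
            ← ENNReal.ofReal_mul (by positivity), ← ENNReal.ofReal_mul (by positivity),
            ← Real.exp_add, ← Real.exp_add, ← Real.exp_add, hu]
          refine le_of_eq ?_
          congr 2
          simp only [sub_dotProduct, smul_dotProduct, dotProduct_add, smul_eq_mul]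
          ring
        · rw [Set.indicator_of_notMem hz]
          exact zero_le

/-! ### Exponential moments from linearly growing `Lᵖ` norms -/

theorem ofReal_exp_sub_le_tsum (x : ℝ) :
    ENNReal.ofReal (Real.exp x - 1 - x) ≤
      ∑' k : ℕ, ENNReal.ofReal (|x| ^ (k + 2) / (k + 2).factorial) := by
  have hs : HasSum (fun k : ℕ => |x| ^ k / k.factorial) (Real.exp |x|) := by
    rw [Real.exp_eq_exp_ℝ]; exact NormedSpace.expSeries_div_hasSum_exp |x|
  have hs2 : HasSum (fun k : ℕ => |x| ^ (k + 2) / (k + 2).factorial) (Real.exp |x| - 1 - |x|) := by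
    have := (hasSum_nat_add_iff' 2).2 hs
    simpa [Finset.sum_range_succ, sub_sub] using this
  rw [← ENNReal.ofReal_tsum_of_nonneg (fun k => by positivity) hs2.summable, hs2.tsum_eq]
  refine ENNReal.ofReal_le_ofReal ?_
  rcases le_total 0 x with h | h
  · rw [abs_of_nonneg h]
  · rw [abs_of_nonpos h]
    -- For `x ≤ 0`, `exp x - x ≤ exp (-x) + x` is exactly `-x ≤ sinh (-x)`.
    have := Real.self_le_sinh_iff.2 (neg_nonneg.2 h)
    rw [Real.sinh_eq] at this
    simp only [neg_neg] at this
    linarith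

/-- Since `kᵏ / k! ≤ eᵏ`, the `k`-th Taylor term contributes at most `(e b)ᵏ`. The geometric series
from `k = 2` has ratio at most `1/2`, whence the factor 2. -/
theorem lintegral_exp_sub_le {Ω : Type*} [MeasurableSpace Ω] {μ : Measure Ω} {X : Ω → ℝ}
    (hX : AEMeasurable X μ) {b : ℝ} (hb : 0 ≤ b) (hb2 : Real.exp 1 * b ≤ 1 / 2)
    (hmom : ∀ k : ℕ, 2 ≤ k → eLpNorm X k μ ≤ ENNReal.ofReal (b * k)) :
    ∫⁻ ω, ENNReal.ofReal (Real.exp (X ω) - 1 - X ω) ∂μ ≤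
      ENNReal.ofReal (2 * (Real.exp 1 * b) ^ 2) := by
  set a := Real.exp 1 * b with ha
  have ha0 : 0 ≤ a := by positivity
  have hk : ∀ k : ℕ, ∫⁻ ω, ENNReal.ofReal (|X ω| ^ (k + 2) / (k + 2).factorial) ∂μ ≤
      ENNReal.ofReal (a ^ (k + 2)) := by
    intro k
    have h1 : ∫⁻ ω, ENNReal.ofReal (|X ω| ^ (k + 2)) ∂μ ≤
        ENNReal.ofReal ((b * (k + 2 : ℕ)) ^ (k + 2)) := by
      have h2 := hmom (k + 2) (by omega)
      rw [eLpNorm_eq_lintegral_rpow_enorm_toReal (by simp) (by finiteness)] at h2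
      rw [one_div, ENNReal.rpow_inv_le_iff
        (by rw [ENNReal.toReal_natCast]; exact_mod_cast Nat.succ_pos (k + 1))] at h2
      simp only [ENNReal.toReal_natCast, ENNReal.rpow_natCast] at h2
      rw [ENNReal.ofReal_pow (by positivity)]
      refine le_trans (le_of_eq (lintegral_congr fun ω => ?_)) h2
      rw [ENNReal.ofReal_pow (abs_nonneg _), Real.enorm_eq_ofReal_abs]
    calc ∫⁻ ω, ENNReal.ofReal (|X ω| ^ (k + 2) / (k + 2).factorial) ∂μ
        = ENNReal.ofReal (1 / (k + 2).factorial) * ∫⁻ ω, ENNReal.ofReal (|X ω| ^ (k + 2)) ∂μ := by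
          rw [← lintegral_const_mul'' _ (by fun_prop)]
          refine lintegral_congr fun ω => ?_
          rw [← ENNReal.ofReal_mul (by positivity)]
          congr 1; ring
      _ ≤ ENNReal.ofReal (1 / (k + 2).factorial) *
          ENNReal.ofReal ((b * (k + 2 : ℕ)) ^ (k + 2)) := by gcongr
      _ ≤ ENNReal.ofReal (a ^ (k + 2)) := by
          rw [← ENNReal.ofReal_mul (by positivity)]
          refine ENNReal.ofReal_le_ofReal ?_
          have h3 := Real.pow_div_factorial_le_exp ((k + 2 : ℕ) : ℝ) (by positivity) (k + 2)
          have h4 : Real.exp ((k + 2 : ℕ) : ℝ) = Real.exp 1 ^ (k + 2) := by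
            rw [← Real.exp_nat_mul, mul_one]
          rw [h4] at h3
          rw [ha, mul_pow, mul_pow]
          calc _ = ((k + 2 : ℕ) : ℝ) ^ (k + 2) / (k + 2).factorial * b ^ (k + 2) := by ring
            _ ≤ _ := by gcongr
  calc ∫⁻ ω, ENNReal.ofReal (Real.exp (X ω) - 1 - X ω) ∂μ
      ≤ ∫⁻ ω, ∑' k : ℕ, ENNReal.ofReal (|X ω| ^ (k + 2) / (k + 2).factorial) ∂μ :=
        lintegral_mono fun ω => ofReal_exp_sub_le_tsum _
    _ = ∑' k : ℕ, ∫⁻ ω, ENNReal.ofReal (|X ω| ^ (k + 2) / (k + 2).factorial) ∂μ :=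
        lintegral_tsum fun k => by fun_prop
    _ ≤ ∑' k : ℕ, ENNReal.ofReal (a ^ (k + 2)) := ENNReal.tsum_le_tsum hk
    _ ≤ ENNReal.ofReal (2 * a ^ 2) := by
        have hg : HasSum (fun k : ℕ => a ^ (k + 2)) ((1 - a)⁻¹ * a ^ 2) := by
          simp_rw [pow_add]
          exact (hasSum_geometric_of_lt_one ha0 (by linarith)).mul_right _
        rw [← ENNReal.ofReal_tsum_of_nonneg (fun k => by positivity) hg.summable, hg.tsum_eq]
        refine ENNReal.ofReal_le_ofReal ?_
        gcongr
        rw [inv_le_comm₀ (by linarith) (by norm_num)]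
        linarith

/-- The preceding bound gives `E exp X ≤ 1 + E X + 2 (e b)²`; then `1 + y ≤ exp y` absorbs the mean.
-/
theorem lintegral_exp_centered_le {Ω : Type*} [MeasurableSpace Ω] {μ : Measure Ω}
    [IsProbabilityMeasure μ] {X : Ω → ℝ} (hX : Integrable X μ) {b : ℝ} (hb : 0 ≤ b)
    (hb2 : Real.exp 1 * b ≤ 1 / 2)
    (hmom : ∀ k : ℕ, 2 ≤ k → eLpNorm X k μ ≤ ENNReal.ofReal (b * k)) :
    ∫⁻ ω, ENNReal.ofReal (Real.exp (X ω - ∫ ω, X ω ∂μ)) ∂μ ≤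
      ENNReal.ofReal (Real.exp (2 * (Real.exp 1 * b) ^ 2)) := by
  have hm := hX.aemeasurable
  have h1 := lintegral_exp_sub_le hm hb hb2 hmom
  have hnn : 0 ≤ᵐ[μ] fun ω => Real.exp (X ω) - 1 - X ω :=
    Filter.Eventually.of_forall fun ω => by
      have := Real.add_one_le_exp (X ω)
      simp only [Pi.zero_apply]
      linarith
  have hgm : AEStronglyMeasurable (fun ω => Real.exp (X ω) - 1 - X ω) μ :=
    AEMeasurable.aestronglyMeasurable (by fun_prop)
  have hgi : Integrable (fun ω => Real.exp (X ω) - 1 - X ω) μ := by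
    refine ⟨hgm, ?_⟩
    rw [hasFiniteIntegral_iff_ofReal hnn]
    exact h1.trans_lt ENNReal.ofReal_lt_top
  rw [← ofReal_integral_eq_lintegral_ofReal hgi hnn,
    ENNReal.ofReal_le_ofReal_iff (by positivity)] at h1
  have hei : Integrable (fun ω => Real.exp (X ω)) μ := by
    have := (hgi.add (integrable_const (1 : ℝ))).add hX
    refine this.congr (Filter.Eventually.of_forall fun ω => ?_)
    simp only [Pi.add_apply]
    ring
  have hei' : Integrable (fun ω => Real.exp (X ω - ∫ ω, X ω ∂μ)) μ := by
    simp_rw [Real.exp_sub]; exact hei.div_const _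
  rw [← ofReal_integral_eq_lintegral_ofReal hei'
    (Filter.Eventually.of_forall fun ω => (Real.exp_pos _).le)]
  refine ENNReal.ofReal_le_ofReal ?_
  simp_rw [Real.exp_sub]
  rw [integral_div, div_le_iff₀ (Real.exp_pos _), ← Real.exp_add]
  have h2 : ∫ ω, Real.exp (X ω) - 1 - X ω ∂μ = ∫ ω, Real.exp (X ω) ∂μ - 1 - ∫ ω, X ω ∂μ := by
    have h := integral_sub (hei.sub (integrable_const (1 : ℝ))) hX
    rw [integral_sub' hei (integrable_const _)] at h
    simpa using h
  have h3 := Real.add_one_le_exp (2 * (Real.exp 1 * b) ^ 2 + ∫ ω, X ω ∂μ)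
  linarith

/-! ### Bilinear forms of a random positive semidefinite matrix -/

theorem measurable_bilin {α : Type*} [MeasurableSpace α] {l : ℕ}
    {A : α → Matrix (Fin l) (Fin l) ℝ} {x y : α → Fin l → ℝ}
    (hA : ∀ i j, Measurable fun a => A a i j) (hx : Measurable x) (hy : Measurable y) :
    Measurable fun a => x a ⬝ᵥ (A a *ᵥ y a) := by
  simp only [dotProduct, Matrix.mulVec]
  fun_prop

theorem measurable_matrix_entry {l : ℕ} (i j : Fin l) :
    Measurable fun M : Matrix (Fin l) (Fin l) ℝ => M i j :=
  (measurable_pi_apply (X := fun _ => ℝ) j).comp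
    (measurable_pi_apply (X := fun _ => Fin l → ℝ) i)

theorem measurable_matrix_bilin {l : ℕ} (x y : Fin l → ℝ) :
    Measurable fun M : Matrix (Fin l) (Fin l) ℝ => x ⬝ᵥ (M *ᵥ y) :=
  measurable_bilin measurable_matrix_entry measurable_const measurable_const

theorem bilin_comm_of_isHermitian {l : ℕ} {M : Matrix (Fin l) (Fin l) ℝ} (hM : M.IsHermitian)
    (x y : Fin l → ℝ) : y ⬝ᵥ (M *ᵥ x) = x ⬝ᵥ (M *ᵥ y) := by
  have h : Mᵀ = M := by rw [← Matrix.conjTranspose_eq_transpose_of_trivial]; exact hM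
  rw [Matrix.dotProduct_mulVec, ← Matrix.mulVec_transpose, h, dotProduct_comm]

/-- Polarisation: this transfers the moment hypothesis from quadratic to bilinear forms. -/
theorem abs_bilin_le_of_posSemidef {l : ℕ} {M : Matrix (Fin l) (Fin l) ℝ} (hM : M.PosSemidef)
    (x y : Fin l → ℝ) :
    |x ⬝ᵥ (M *ᵥ y)| ≤ 1 / 2 * (x ⬝ᵥ (M *ᵥ x)) + 1 / 2 * (y ⬝ᵥ (M *ᵥ y)) := by
  have hs := bilin_comm_of_isHermitian hM.1 x y
  have h1 : 0 ≤ (x - y) ⬝ᵥ (M *ᵥ (x - y)) := by simpa using hM.dotProduct_mulVec_nonneg (x - y)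
  have h2 : 0 ≤ (x + y) ⬝ᵥ (M *ᵥ (x + y)) := by simpa using hM.dotProduct_mulVec_nonneg (x + y)
  simp only [Matrix.mulVec_sub, Matrix.mulVec_add, dotProduct_sub, sub_dotProduct, dotProduct_add,
    add_dotProduct] at h1 h2
  rw [abs_le]
  constructor <;> linarith

section Moments

variable {Ω : Type*} [MeasurableSpace Ω] {μ : Measure Ω} {l : ℕ}
  {Z : Ω → Matrix (Fin l) (Fin l) ℝ} {S : Matrix (Fin l) (Fin l) ℝ} {η : ℝ}

theorem eLpNorm_bilin_le (hZm : AEMeasurable Z μ) (hZ : ∀ᵐ ω ∂μ, (Z ω).PosSemidef) (hη : 0 ≤ η)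
    (hmom : ∀ p : ℝ, 1 ≤ p → ∀ u : Fin l → ℝ,
      eLpNorm (fun ω => u ⬝ᵥ (Z ω *ᵥ u)) (ENNReal.ofReal p) μ
        ≤ ENNReal.ofReal (η * p * matNorm S u ^ 2))
    {p : ℝ} (hp : 1 ≤ p) (x y : Fin l → ℝ) :
    eLpNorm (fun ω => x ⬝ᵥ (Z ω *ᵥ y)) (ENNReal.ofReal p) μ ≤
      ENNReal.ofReal (η * p * (1 / 2 * matNorm S x ^ 2 + 1 / 2 * matNorm S y ^ 2)) := by
  have hm : ∀ x y : Fin l → ℝ, AEStronglyMeasurable (fun ω => x ⬝ᵥ (Z ω *ᵥ y)) μ := fun x y =>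
    ((measurable_matrix_bilin x y).comp_aemeasurable hZm).aestronglyMeasurable
  have h2 : ∀ x : Fin l → ℝ, eLpNorm (fun ω => (1 / 2 : ℝ) * (x ⬝ᵥ (Z ω *ᵥ x)))
      (ENNReal.ofReal p) μ ≤ ENNReal.ofReal (1 / 2 * (η * p * matNorm S x ^ 2)) := fun x => by
    have := eLpNorm_const_smul (1 / 2 : ℝ) (fun ω => x ⬝ᵥ (Z ω *ᵥ x)) (ENNReal.ofReal p) μ
    refine (le_of_eq this).trans ?_
    rw [ENNReal.ofReal_mul (by norm_num), Real.enorm_eq_ofReal (by norm_num)]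
    gcongr
    exact hmom p hp x
  calc eLpNorm (fun ω => x ⬝ᵥ (Z ω *ᵥ y)) (ENNReal.ofReal p) μ
      ≤ eLpNorm ((fun ω => 1 / 2 * (x ⬝ᵥ (Z ω *ᵥ x))) + fun ω => 1 / 2 * (y ⬝ᵥ (Z ω *ᵥ y)))
          (ENNReal.ofReal p) μ := by
        refine eLpNorm_mono_ae_real ?_
        filter_upwards [hZ] with ω hω
        exact abs_bilin_le_of_posSemidef hω x y
    _ ≤ _ := eLpNorm_add_le ((hm x x).const_mul _) ((hm y y).const_mul _)
        (by simpa using ENNReal.ofReal_le_ofReal hp)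
    _ ≤ _ := add_le_add (h2 x) (h2 y)
    _ = _ := by
        rw [← ENNReal.ofReal_add (by positivity) (by positivity)]
        congr 1; ring

theorem integrable_bilin (hZm : AEMeasurable Z μ) (hZ : ∀ᵐ ω ∂μ, (Z ω).PosSemidef) (hη : 0 ≤ η)
    (hmom : ∀ p : ℝ, 1 ≤ p → ∀ u : Fin l → ℝ,
      eLpNorm (fun ω => u ⬝ᵥ (Z ω *ᵥ u)) (ENNReal.ofReal p) μ
        ≤ ENNReal.ofReal (η * p * matNorm S u ^ 2)) (x y : Fin l → ℝ) :
    Integrable (fun ω => x ⬝ᵥ (Z ω *ᵥ y)) μ := by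
  rw [← memLp_one_iff_integrable]
  refine ⟨((measurable_matrix_bilin x y).comp_aemeasurable hZm).aestronglyMeasurable, ?_⟩
  have := eLpNorm_bilin_le hZm hZ hη hmom le_rfl x y
  rw [ENNReal.ofReal_one] at this
  exact this.trans_lt ENNReal.ofReal_lt_top

theorem integral_bilin_eq (hint : ∀ x y : Fin l → ℝ, Integrable (fun ω => x ⬝ᵥ (Z ω *ᵥ y)) μ)
    (x y : Fin l → ℝ) : ∫ ω, x ⬝ᵥ (Z ω *ᵥ y) ∂μ = x ⬝ᵥ (matMean μ Z *ᵥ y) := by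
  have he : ∀ i j, Integrable (fun ω => Z ω i j) μ := fun i j => by
    simpa using hint (Pi.single i 1) (Pi.single j 1)
  simp only [dotProduct, Matrix.mulVec, matMean, Matrix.of_apply]
  rw [integral_finsetSum _ fun i _ =>
    (integrable_finsetSum _ fun j _ => (he i j).mul_const _).const_mul _]
  refine Finset.sum_congr rfl fun i _ => ?_
  rw [integral_const_mul, integral_finsetSum _ fun j _ => (he i j).mul_const _]
  congr 1
  exact Finset.sum_congr rfl fun j _ => integral_mul_const _ _

theorem posSemidef_matMean (hZ : ∀ᵐ ω ∂μ, (Z ω).PosSemidef)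
    (hint : ∀ x y : Fin l → ℝ, Integrable (fun ω => x ⬝ᵥ (Z ω *ᵥ y)) μ) :
    (matMean μ Z).PosSemidef := by
  refine Matrix.PosSemidef.of_dotProduct_mulVec_nonneg ?_ fun x => ?_
  · ext i j
    simp only [Matrix.conjTranspose_apply, matMean, Matrix.of_apply, star_trivial]
    refine integral_congr_ae ?_
    filter_upwards [hZ] with ω hω
    simpa using hω.1.apply i j
  · rw [star_trivial, ← integral_bilin_eq hint]
    refine integral_nonneg_of_ae ?_
    filter_upwards [hZ] with ω hω
    simpa using hω.dotProduct_mulVec_nonneg x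

end Moments

/-! ### The PAC-Bayesian deviation bound -/

theorem bilin_sum_sub {l n : ℕ} (M : Fin n → Matrix (Fin l) (Fin l) ℝ)
    (S : Matrix (Fin l) (Fin l) ℝ) (x y : Fin l → ℝ) :
    x ⬝ᵥ ((∑ i, M i - (n : ℝ) • S) *ᵥ y) = ∑ i, (x ⬝ᵥ (M i *ᵥ y) - x ⬝ᵥ (S *ᵥ y)) := by
  rw [Matrix.sub_mulVec, dotProduct_sub, Matrix.sum_mulVec, dotProduct_sum, Matrix.smul_mulVec,
    dotProduct_smul, Finset.sum_sub_distrib]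
  simp

theorem lintegral_exp_sum_le {Ω : Type*} [MeasurableSpace Ω] {μ : Measure Ω} {l n : ℕ}
    {M : Fin n → Ω → Matrix (Fin l) (Fin l) ℝ} (hM : ∀ i, Measurable (M i))
    (hind : iIndepFun M μ) (S : Matrix (Fin l) (Fin l) ℝ) (lam b : ℝ) (x y : Fin l → ℝ)
    (hmgf : ∀ i, ∫⁻ ω, ENNReal.ofReal
      (Real.exp (lam * (x ⬝ᵥ (M i ω *ᵥ y) - x ⬝ᵥ (S *ᵥ y)))) ∂μ ≤ ENNReal.ofReal (Real.exp b)) :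
    ∫⁻ ω, ENNReal.ofReal
      (Real.exp (lam * (x ⬝ᵥ ((∑ i, M i ω - (n : ℝ) • S) *ᵥ y)) - n * b)) ∂μ ≤ 1 := by
  set F : Matrix (Fin l) (Fin l) ℝ → ℝ≥0∞ := fun A =>
    ENNReal.ofReal (Real.exp (lam * (x ⬝ᵥ (A *ᵥ y) - x ⬝ᵥ (S *ᵥ y)))) with hF
  have hFm : Measurable F := by
    have := measurable_matrix_bilin x y
    fun_prop
  have h1 : ∀ ω, ENNReal.ofReal
      (Real.exp (lam * (x ⬝ᵥ ((∑ i, M i ω - (n : ℝ) • S) *ᵥ y)) - n * b)) =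
      ENNReal.ofReal (Real.exp (-(n * b))) * ∏ i, F (M i ω) := fun ω => by
    rw [← ENNReal.ofReal_prod_of_nonneg (fun i _ => (Real.exp_pos _).le), ← Real.exp_sum,
      ← ENNReal.ofReal_mul (Real.exp_pos _).le, ← Real.exp_add, bilin_sum_sub, Finset.mul_sum]
    congr 2
    ring
  simp_rw [h1]
  rw [lintegral_const_mul _ (by fun_prop)]
  rw [lintegral_prod_eq_prod_lintegral_of_indepFun Finset.univ (fun i ω => F (M i ω))
    (hind.comp (fun _ => F) fun _ => hFm) (fun i => hFm.comp (hM i))]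
  calc ENNReal.ofReal (Real.exp (-(n * b))) * ∏ i, ∫⁻ ω, F (M i ω) ∂μ
      ≤ ENNReal.ofReal (Real.exp (-(n * b))) * ∏ _i : Fin n, ENNReal.ofReal (Real.exp b) := by
        gcongr with i
        exact hmgf i
    _ = 1 := by
        rw [Finset.prod_const, Finset.card_univ, Fintype.card_fin,
          ← ENNReal.ofReal_pow (Real.exp_pos _).le, ← ENNReal.ofReal_mul (Real.exp_pos _).le,
          ← Real.exp_nat_mul, ← Real.exp_add]
        simp

theorem measurable_ofReal_exp_bilin {α : Type*} [MeasurableSpace α] {l : ℕ}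
    {A : α → Matrix (Fin l) (Fin l) ℝ} {x y : α → Fin l → ℝ}
    (hA : ∀ i j, Measurable fun a => A a i j) (hx : Measurable x) (hy : Measurable y) (c d : ℝ) :
    Measurable fun a => ENNReal.ofReal (Real.exp (c * (x a ⬝ᵥ (A a *ᵥ y a)) - d)) := by
  have := measurable_bilin hA hx hy
  fun_prop

/-- A PAC-Bayesian deviation bound, uniform over pairs of unit vectors, for a sum of independent
random matrices whose bilinear forms have controlled exponential moments. -/
theorem pacBayes_bilin {Ω : Type*} [MeasurableSpace Ω] {μ : Measure Ω} [IsProbabilityMeasure μ]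
    {l n : ℕ} {M : Fin n → Ω → Matrix (Fin l) (Fin l) ℝ} (hM : ∀ i, Measurable (M i))
    (hind : iIndepFun M μ) {S : Matrix (Fin l) (Fin l) ℝ} (hS : S.PosSemidef)
    {s : ℝ} (hs : 0 < s) {v : NNReal} (hv : v ≠ 0) (htr : v * S.trace ≤ s) {lam b : ℝ}
    (hmgf : ∀ i x y, x ⬝ᵥ (S *ᵥ x) ≤ 6 * s → y ⬝ᵥ (S *ᵥ y) ≤ 6 * s → ∫⁻ ω, ENNReal.ofReal
      (Real.exp (lam * (x ⬝ᵥ (M i ω *ᵥ y) - x ⬝ᵥ (S *ᵥ y)))) ∂μ ≤ ENNReal.ofReal (Real.exp b))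
    (t : ℝ) :
    ENNReal.ofReal (1 - Real.exp (-t)) ≤ μ {ω | ∀ u w : Fin l → ℝ, u ⬝ᵥ u = 1 → w ⬝ᵥ w = 1 →
      u ⬝ᵥ (S *ᵥ u) ≤ s → w ⬝ᵥ (S *ᵥ w) ≤ s →
      lam * (u ⬝ᵥ ((∑ i, M i ω - (n : ℝ) • S) *ᵥ w)) ≤
        n * b + 2 * Real.log 2 + 1 / v + t} := by
  set G : Set (Fin l → ℝ) := {x | x ⬝ᵥ (S *ᵥ x) ≤ 6 * s} with hGdef
  have hG : MeasurableSet G := measurableSet_le (by fun_prop) measurable_const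
  set A : Ω → Matrix (Fin l) (Fin l) ℝ := fun ω => ∑ i, M i ω - (n : ℝ) • S with hA
  have hAm : ∀ i j, Measurable fun ω => A ω i j := fun i j => by
    simp only [hA, Matrix.sub_apply, Matrix.sum_apply, Matrix.smul_apply]
    have : ∀ k, Measurable fun ω => M k ω i j := fun k => (measurable_matrix_entry i j).comp (hM k)
    fun_prop
  set f : Ω → (Fin l → ℝ) → (Fin l → ℝ) → ℝ≥0∞ := fun ω x y =>
    ENNReal.ofReal (Real.exp (lam * (x ⬝ᵥ (A ω *ᵥ y)) - n * b)) with hf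
  set γ := isoGaussian l v
  have hinner : Measurable fun q : Ω × (Fin l → ℝ) => ∫⁻ y in G, f q.1 q.2 y ∂γ := by
    have : Measurable fun q : (Ω × (Fin l → ℝ)) × (Fin l → ℝ) => f q.1.1 q.1.2 q.2 :=
      measurable_ofReal_exp_bilin (fun i j => (hAm i j).comp (measurable_fst.comp measurable_fst))
        (by fun_prop) (by fun_prop) lam (n * b)
    exact this.lintegral_prod_right'
  set W : Ω → ℝ≥0∞ := fun ω => ∫⁻ x in G, ∫⁻ y in G, f ω x y ∂γ ∂γ with hW
  have hWm : Measurable W := hinner.lintegral_prod_right'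
  have hEW : ∫⁻ ω, W ω ∂μ ≤ 1 := by
    rw [hW, lintegral_lintegral_swap hinner.aemeasurable]
    calc ∫⁻ x in G, ∫⁻ ω, ∫⁻ y in G, f ω x y ∂γ ∂μ ∂γ ≤ ∫⁻ x in G, 1 ∂γ := by
          refine setLIntegral_mono measurable_const fun x hx => ?_
          have hxm : Measurable fun q : Ω × (Fin l → ℝ) => f q.1 x q.2 :=
            measurable_ofReal_exp_bilin (fun i j => (hAm i j).comp measurable_fst)
              (by fun_prop) (by fun_prop) lam (n * b)
          rw [lintegral_lintegral_swap hxm.aemeasurable]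
          calc ∫⁻ y in G, ∫⁻ ω, f ω x y ∂μ ∂γ ≤ ∫⁻ y in G, 1 ∂γ :=
                setLIntegral_mono measurable_const fun y hy =>
                  lintegral_exp_sum_le hM hind S lam b x y fun i => hmgf i x y hx hy
            _ ≤ 1 := by simpa using prob_le_one
      _ ≤ 1 := by simpa using prob_le_one
  have hmark := mul_meas_ge_le_lintegral (μ := μ) hWm (ENNReal.ofReal (Real.exp t))
  have hbad : μ {ω | ENNReal.ofReal (Real.exp t) ≤ W ω} ≤ ENNReal.ofReal (Real.exp (-t)) := by
    rw [Real.exp_neg, ENNReal.ofReal_inv_of_pos (Real.exp_pos t), ← one_div,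
      ENNReal.le_div_iff_mul_le (by simp [Real.exp_pos]) (by simp), mul_comm]
    exact hmark.trans hEW
  have hbm : MeasurableSet {ω | ENNReal.ofReal (Real.exp t) ≤ W ω} :=
    measurableSet_le measurable_const hWm
  calc ENNReal.ofReal (1 - Real.exp (-t))
      = 1 - ENNReal.ofReal (Real.exp (-t)) := by
        rw [ENNReal.ofReal_sub _ (Real.exp_pos _).le, ENNReal.ofReal_one]
    _ ≤ 1 - μ {ω | ENNReal.ofReal (Real.exp t) ≤ W ω} := by gcongr
    _ = μ {ω | ENNReal.ofReal (Real.exp t) ≤ W ω}ᶜ := (prob_compl_eq_one_sub hbm).symm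
    _ ≤ _ := measure_mono fun ω hω => ?_
  simp only [Set.mem_compl_iff, Set.mem_ofPred_eq, not_le] at hω ⊢
  intro u w hu hw huS hwS
  set κ := 1 / 2 * Real.exp (-(1 / (2 * v))) with hκ
  have hκ0 : 0 < κ := by positivity
  -- The exponent is affine in each variable separately, so the smoothing bound applies in `y`
  -- around `w` for fixed `x`, then in `x` around `u`; each use costs a factor `κ`.
  have hlow : ENNReal.ofReal (κ * (κ * Real.exp (lam * (u ⬝ᵥ (A ω *ᵥ w)) - n * b))) ≤ W ω := by
    have hy : ∀ x : Fin l → ℝ, ENNReal.ofReal (κ * Real.exp (-(n * b) +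
        (lam • (A ω *ᵥ w)) ⬝ᵥ x)) ≤ ∫⁻ y in G, f ω x y ∂γ := fun x => by
      have h := le_setLIntegral_exp_affine hv hS hs htr hw hwS (-(n * b)) (lam • (x ᵥ* A ω))
      convert h using 1
      · congr 4
        rw [smul_dotProduct, smul_dotProduct, dotProduct_comm, Matrix.dotProduct_mulVec]
      · refine lintegral_congr fun y => ?_
        simp only [hf]
        rw [smul_dotProduct, ← Matrix.dotProduct_mulVec, smul_eq_mul]
        congr 2; ring
    have hx := le_setLIntegral_exp_affine hv hS hs htr hu huS (-(n * b)) (lam • (A ω *ᵥ w))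
    calc _ = ENNReal.ofReal κ * ENNReal.ofReal
          (κ * Real.exp (-(n * b) + (lam • (A ω *ᵥ w)) ⬝ᵥ u)) := by
          rw [← ENNReal.ofReal_mul hκ0.le]
          congr 4
          rw [smul_dotProduct, dotProduct_comm, smul_eq_mul]; ring
      _ ≤ ENNReal.ofReal κ * ∫⁻ x in G, ENNReal.ofReal
          (Real.exp (-(n * b) + (lam • (A ω *ᵥ w)) ⬝ᵥ x)) ∂γ := by gcongr
      _ = ∫⁻ x in G, ENNReal.ofReal (κ * Real.exp (-(n * b) + (lam • (A ω *ᵥ w)) ⬝ᵥ x)) ∂γ := by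
          rw [← lintegral_const_mul _ (by fun_prop)]
          simp_rw [ENNReal.ofReal_mul hκ0.le]
      _ ≤ W ω := lintegral_mono hy
  have h3 := hlow.trans_lt hω
  rw [ENNReal.ofReal_lt_ofReal_iff (Real.exp_pos t)] at h3
  have h4 : κ = Real.exp (-Real.log 2 - 1 / (2 * v)) := by
    rw [hκ, sub_eq_add_neg, Real.exp_add, Real.exp_neg (Real.log 2), Real.exp_log (by norm_num)]
    norm_num
  rw [h4, ← Real.exp_add, ← Real.exp_add, Real.exp_lt_exp] at h3
  have h5 : (1 : ℝ) / v = 1 / (2 * v) + 1 / (2 * v) := by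
    have hv' : (v : ℝ) ≠ 0 := by exact_mod_cast hv
    field_simp; norm_num
  rw [h5]
  linarith

/-! ### Operator norm and trace -/

theorem opNorm_zero {l : ℕ} : opNorm (0 : Matrix (Fin l) (Fin l) ℝ) = 0 := by simp [opNorm]

theorem opNorm_pos {l : ℕ} {A : Matrix (Fin l) (Fin l) ℝ} (hA : A ≠ 0) : 0 < opNorm A := by
  unfold opNorm
  rw [norm_pos_iff]
  simpa using hA

/-- Test with `w = x / ‖x‖` and `u = A x / ‖A x‖`. With two free vectors a one-sided bound suffices.
-/
theorem opNorm_le_of_bilin_le {l : ℕ} {A : Matrix (Fin l) (Fin l) ℝ} {c : ℝ} (hc : 0 ≤ c)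
    (h : ∀ u w : Fin l → ℝ, u ⬝ᵥ u = 1 → w ⬝ᵥ w = 1 → u ⬝ᵥ (A *ᵥ w) ≤ c) : opNorm A ≤ c := by
  refine ContinuousLinearMap.opNorm_le_bound _ hc fun x => ?_
  set T := Matrix.toEuclideanCLM (n := Fin l) (𝕜 := ℝ) A with hT
  rcases eq_or_ne (T x) 0 with h0 | h0
  · rw [h0, norm_zero]; positivity
  have hx : x ≠ 0 := fun hx => h0 (by rw [hx, map_zero])
  have hself : ∀ z : EuclideanSpace ℝ (Fin l), z.ofLp ⬝ᵥ z.ofLp = ‖z‖ ^ 2 := fun z => by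
    rw [← real_inner_self_eq_norm_sq, EuclideanSpace.inner_eq_star_dotProduct]
    simp
  have hTx : (T x).ofLp = A *ᵥ x.ofLp := Matrix.ofLp_toEuclideanCLM A x
  have hnx : ‖x‖ ≠ 0 := norm_ne_zero_iff.2 hx
  have hnT : ‖T x‖ ≠ 0 := norm_ne_zero_iff.2 h0
  have h1 := h (‖T x‖⁻¹ • (T x).ofLp) (‖x‖⁻¹ • x.ofLp)
    (by rw [smul_dotProduct, dotProduct_smul, hself, smul_eq_mul, smul_eq_mul]; field_simp)
    (by rw [smul_dotProduct, dotProduct_smul, hself, smul_eq_mul, smul_eq_mul]; field_simp)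
  rw [Matrix.mulVec_smul, ← hTx, smul_dotProduct, dotProduct_smul, hself, smul_eq_mul,
    smul_eq_mul] at h1
  have h2 : ‖T x‖⁻¹ * (‖x‖⁻¹ * ‖T x‖ ^ 2) = ‖T x‖ / ‖x‖ := by field_simp
  rwa [h2, div_le_iff₀ (by positivity)] at h1

theorem quadForm_le_opNorm {l : ℕ} (A : Matrix (Fin l) (Fin l) ℝ) {u : Fin l → ℝ}
    (hu : u ⬝ᵥ u = 1) : u ⬝ᵥ (A *ᵥ u) ≤ opNorm A := by
  set x : EuclideanSpace ℝ (Fin l) := WithLp.toLp 2 u with hx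
  have hn : ‖x‖ = 1 := by
    have : ‖x‖ ^ 2 = 1 := by
      rw [← real_inner_self_eq_norm_sq, EuclideanSpace.inner_eq_star_dotProduct]
      simpa using hu
    nlinarith [norm_nonneg x]
  have h1 := real_inner_le_norm x (Matrix.toEuclideanCLM (n := Fin l) (𝕜 := ℝ) A x)
  have h2 := (Matrix.toEuclideanCLM (n := Fin l) (𝕜 := ℝ) A).le_opNorm x
  rw [hn, mul_one] at h2
  rw [hn, one_mul, EuclideanSpace.inner_eq_star_dotProduct, Matrix.ofLp_toEuclideanCLM, star_trivial,
    dotProduct_comm] at h1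
  exact h1.trans h2

/-- Cauchy–Schwarz on each term of a decomposition of `S` into rank-one matrices. -/
theorem quadForm_le_trace {l : ℕ} {S : Matrix (Fin l) (Fin l) ℝ} (hS : S.PosSemidef)
    {u : Fin l → ℝ} (hu : u ⬝ᵥ u = 1) : u ⬝ᵥ (S *ᵥ u) ≤ S.trace := by
  obtain ⟨m, b, rfl⟩ := Matrix.posSemidef_iff_eq_sum_vecMulVec.1 hS
  have h3 : ∑ j, u j ^ 2 = 1 := by rw [← hu]; simp [dotProduct, sq]
  rw [Matrix.sum_mulVec, dotProduct_sum, Matrix.trace_sum]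
  refine Finset.sum_le_sum fun i _ => ?_
  have h2 := Finset.sum_mul_sq_le_sq_mul_sq Finset.univ (b i) u
  rw [h3, mul_one] at h2
  rw [star_trivial, Matrix.trace_vecMulVec, Matrix.vecMulVec_mulVec]
  simpa [dotProduct, sq, mul_comm, Finset.sum_mul, Finset.mul_sum, mul_assoc] using h2

theorem opNorm_le_trace {l : ℕ} {S : Matrix (Fin l) (Fin l) ℝ} (hS : S.PosSemidef) :
    opNorm S ≤ S.trace := by
  refine opNorm_le_of_bilin_le hS.trace_nonneg fun u w hu hw => ?_
  have h1 := (le_abs_self _).trans (abs_bilin_le_of_posSemidef hS u w)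
  linarith [quadForm_le_trace hS hu, quadForm_le_trace hS hw]

/-! ### Exponential moments of the bilinear forms, and the degenerate case -/

section Moments

variable {Ω : Type*} [MeasurableSpace Ω] {μ : Measure Ω} {l : ℕ}
  {Z : Ω → Matrix (Fin l) (Fin l) ℝ} {S : Matrix (Fin l) (Fin l) ℝ} {η : ℝ}

theorem matNorm_sq (hS : S.PosSemidef) (u : Fin l → ℝ) : matNorm S u ^ 2 = u ⬝ᵥ (S *ᵥ u) :=
  Real.sq_sqrt (by simpa using hS.dotProduct_mulVec_nonneg u)

theorem lintegral_exp_bilin_le [IsProbabilityMeasure μ] (hZm : AEMeasurable Z μ)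
    (hZ : ∀ᵐ ω ∂μ, (Z ω).PosSemidef) (hη : 0 ≤ η) (hS : S = matMean μ Z)
    (hmom : ∀ p : ℝ, 1 ≤ p → ∀ u : Fin l → ℝ,
      eLpNorm (fun ω => u ⬝ᵥ (Z ω *ᵥ u)) (ENNReal.ofReal p) μ
        ≤ ENNReal.ofReal (η * p * matNorm S u ^ 2))
    {lam K : ℝ} (hlam : 0 ≤ lam) (hK : 0 ≤ K) (hsmall : Real.exp 1 * (lam * η * K) ≤ 1 / 2)
    {x y : Fin l → ℝ} (hx : x ⬝ᵥ (S *ᵥ x) ≤ K) (hy : y ⬝ᵥ (S *ᵥ y) ≤ K) :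
    ∫⁻ ω, ENNReal.ofReal (Real.exp (lam * (x ⬝ᵥ (Z ω *ᵥ y) - x ⬝ᵥ (S *ᵥ y)))) ∂μ ≤
      ENNReal.ofReal (Real.exp (2 * (Real.exp 1 * (lam * η * K)) ^ 2)) := by
  have hint := integrable_bilin hZm hZ hη hmom
  have hSp : S.PosSemidef := hS ▸ posSemidef_matMean hZ hint
  have h := lintegral_exp_centered_le (μ := μ) (X := fun ω => lam * (x ⬝ᵥ (Z ω *ᵥ y)))
    ((hint x y).const_mul lam) (b := lam * η * K) (by positivity) hsmall ?_
  · rw [integral_const_mul, integral_bilin_eq hint, ← hS] at h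
    simpa only [mul_sub] using h
  · intro k hk
    have hk1 : (1 : ℝ) ≤ k := by exact_mod_cast (by omega : 1 ≤ k)
    have h1 := eLpNorm_bilin_le hZm hZ hη hmom hk1 x y
    rw [ENNReal.ofReal_natCast, matNorm_sq hSp, matNorm_sq hSp] at h1
    have h2 := eLpNorm_const_smul lam (fun ω => x ⬝ᵥ (Z ω *ᵥ y)) k μ
    refine (le_of_eq h2).trans ?_
    rw [Real.enorm_eq_ofReal hlam]
    calc _ ≤ _ := mul_le_mul_right h1 _
      _ ≤ _ := by
        rw [← ENNReal.ofReal_mul hlam]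
        refine ENNReal.ofReal_le_ofReal ?_
        have : η * k * (1 / 2 * (x ⬝ᵥ (S *ᵥ x)) + 1 / 2 * (y ⬝ᵥ (S *ᵥ y))) ≤ η * k * K := by
          gcongr; linarith
        calc _ ≤ lam * (η * k * K) := by gcongr
          _ = _ := by ring

theorem ae_eq_zero_of_moment_zero (hZm : AEMeasurable Z μ)
    (hZ : ∀ᵐ ω ∂μ, (Z ω).PosSemidef) (hη : 0 ≤ η)
    (hmom : ∀ p : ℝ, 1 ≤ p → ∀ u : Fin l → ℝ,
      eLpNorm (fun ω => u ⬝ᵥ (Z ω *ᵥ u)) (ENNReal.ofReal p) μ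
        ≤ ENNReal.ofReal (η * p * matNorm (0 : Matrix (Fin l) (Fin l) ℝ) u ^ 2)) :
    Z =ᵐ[μ] 0 := by
  have h : ∀ i j, ∀ᵐ ω ∂μ, Z ω i j = 0 := fun i j => by
    have h1 := eLpNorm_bilin_le hZm hZ hη hmom le_rfl (Pi.single i 1) (Pi.single j 1)
    simp only [matNorm, Matrix.zero_mulVec, dotProduct_zero, Real.sqrt_zero] at h1
    norm_num at h1
    exact (eLpNorm_eq_zero_iff
      ((measurable_matrix_entry i j).comp_aemeasurable hZm).aestronglyMeasurable (by simp)).1 h1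
  have h' : ∀ᵐ ω ∂μ, ∀ i j, Z ω i j = 0 := ae_all_iff.2 fun i => ae_all_iff.2 fun j => h i j
  filter_upwards [h'] with ω hω
  ext i j
  exact hω i j

end Moments

/-! ### Choice of parameters and conclusion -/

theorem tuning_bound {x : ℝ} (hx : 0 < x) :
    2 * (min 1 (Real.sqrt x) / 2) ^ 2 + 2 * x ≤
      10 * Real.sqrt x * max 1 (Real.sqrt (x / 2)) * (min 1 (Real.sqrt x) / 2) := by
  have hq : 0 < Real.sqrt x := Real.sqrt_pos.2 hx
  have hqq : Real.sqrt x ^ 2 = x := Real.sq_sqrt hx.le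
  set q := Real.sqrt x
  rcases le_total q 1 with h | h
  · rw [min_eq_right h]
    have : 1 ≤ max 1 (Real.sqrt (x / 2)) := le_max_left _ _
    nlinarith [mul_pos hq hq]
  · rw [min_eq_left h]
    -- `7/10` is a rational lower bound for `1/√2`.
    have h2 : q * (7 / 10) ≤ Real.sqrt (x / 2) := by
      refine Real.le_sqrt_of_sq_le ?_
      rw [mul_pow, hqq]; nlinarith
    have : q * (7 / 10) ≤ max 1 (Real.sqrt (x / 2)) := h2.trans (le_max_right _ _)
    nlinarith [mul_pos hq hq]

theorem deviation_le_of_tuned {η s r t y x : ℝ} {n : ℕ} (hn : 0 < n) (hη : 1 ≤ η) (hs : 0 < s)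
    (hr : 1 ≤ r) (ht : 0 ≤ t) (hx : x = (2 * r + t) / n)
    (hy : (min 1 (Real.sqrt x) / 2) / (6 * Real.exp 1 * η * s) * y ≤
      n * (2 * (min 1 (Real.sqrt x) / 2) ^ 2) + 2 * Real.log 2 + r + t) :
    1 / n * y ≤ 200 * (η * s * Real.sqrt x * max 1 (Real.sqrt ((r + t / 2) / n))) := by
  have hn' : (0 : ℝ) < n := by exact_mod_cast hn
  have hx0 : 0 < x := by rw [hx]; positivity
  have hx2 : (r + t / 2) / n = x / 2 := by rw [hx]; ring
  have hq : 0 < Real.sqrt x := Real.sqrt_pos.2 hx0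
  rw [hx2]
  have htune := tuning_bound hx0
  set a := min 1 (Real.sqrt x) / 2 with ha
  have ha0 : 0 < a := by positivity
  set m := Real.sqrt x * max 1 (Real.sqrt (x / 2)) with hm
  have hm0 : 0 < m := by positivity
  -- As `r ≥ 1`, this gives `2 log 2 + r + t ≤ 3r + t ≤ 2 n x`.
  have hlog : Real.log 2 ≤ 1 := by linarith [Real.log_two_lt_d9]
  have hnx : n * x = 2 * r + t := by rw [hx]; field_simp
  have h1 : a / (6 * Real.exp 1 * η * s) * y ≤ n * (10 * m * a) := by
    refine hy.trans ?_
    have : n * (2 * a ^ 2) + 2 * (n * x) ≤ n * (10 * m * a) := by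
      have h := mul_le_mul_of_nonneg_left htune hn'.le
      rw [mul_assoc 10 (Real.sqrt x), ← hm] at h
      linarith
    rw [hnx] at this
    linarith
  have h2 : y ≤ n * (10 * m) * (6 * Real.exp 1 * η * s) := by
    rw [div_mul_eq_mul_div, div_le_iff₀ (by positivity)] at h1
    refine le_of_mul_le_mul_left (a := a) ?_ ha0
    linarith
  have he : Real.exp 1 ≤ 3 := by linarith [Real.exp_one_lt_d9]
  -- `6e ≤ 20`, and `10 · 20` is the final constant 200.
  have h3 : y ≤ n * (10 * m) * (20 * η * s) := by
    refine h2.trans ?_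
    gcongr
    linarith
  rw [one_div_mul_eq_div, div_le_iff₀ hn']
  calc y ≤ _ := h3
    _ = _ := by rw [hm]; ring

theorem mainTheorem5 :
    ∃ C : ℝ, 0 < C ∧
      ∀ (l n : ℕ), 0 < n →
      ∀ (Ω₀ : Type*) [MeasurableSpace Ω₀] (μ₀ : Measure Ω₀) [IsProbabilityMeasure μ₀]
        (Z : Ω₀ → Matrix (Fin l) (Fin l) ℝ)
        (Ω : Type*) [MeasurableSpace Ω] (μ : Measure Ω) [IsProbabilityMeasure μ]
        (Zs : Fin n → Ω → Matrix (Fin l) (Fin l) ℝ)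
        (S : Matrix (Fin l) (Fin l) ℝ) (η : ℝ),
        (∀ᵐ ω ∂μ₀, (Z ω).PosSemidef) →
        (∀ i, IdentDistrib (Zs i) Z μ μ₀) →
        iIndepFun Zs μ →
        S = matMean μ₀ Z →
        1 ≤ η →
        (∀ (p : ℝ), 1 ≤ p → ∀ u : Fin l → ℝ,
          eLpNorm (fun ω => u ⬝ᵥ (Z ω *ᵥ u)) (ENNReal.ofReal p) μ₀
            ≤ ENNReal.ofReal (η * p * matNorm S u ^ 2)) →
        ∀ t : ℝ, 0 ≤ t →
          ENNReal.ofReal (1 - Real.exp (-t)) ≤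
            μ {ω | opNorm ((1 / (n : ℝ)) • (∑ i, Zs i ω) - S) ≤
              C * (η * opNorm S * Real.sqrt ((2 * effRank S + t) / n) *
                max 1 (Real.sqrt ((effRank S + t / 2) / n)))} := by
  refine ⟨200, by norm_num, ?_⟩
  intro l n hn Ω₀ _ μ₀ _ Z Ω _ μ _ Zs S η hZ hid hind hS hη hmom t ht
  have hn' : (0 : ℝ) < n := by exact_mod_cast hn
  have hη0 : 0 ≤ η := zero_le_one.trans hη
  have hZm : AEMeasurable Z μ₀ := (hid ⟨0, hn⟩).aemeasurable_snd
  have hZsm : ∀ i, AEMeasurable (Zs i) μ := fun i => (hid i).aemeasurable_fst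
  have hSp : S.PosSemidef := hS ▸ posSemidef_matMean hZ (integrable_bilin hZm hZ hη0 hmom)
  rcases eq_or_ne S 0 with hS0 | hS0
  -- Here the right-hand side is 0, so the samples must be shown to vanish almost surely.
  · rw [hS0] at hmom
    have hZ0 := ae_eq_zero_of_moment_zero hZm hZ hη0 hmom
    have hZs0 : ∀ᵐ ω ∂μ, ∀ i, Zs i ω = 0 := by
      refine ae_all_iff.2 fun i => ?_
      have hms : MeasurableSet {M : Matrix (Fin l) (Fin l) ℝ | M = 0} := by
        have : {M : Matrix (Fin l) (Fin l) ℝ | M = 0} = ⋂ i, ⋂ j, {M | M i j = 0} := by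
          ext M
          simp [← Matrix.ext_iff]
        rw [this]
        exact MeasurableSet.iInter fun i => MeasurableSet.iInter fun j =>
          measurableSet_eq_fun (measurable_matrix_entry i j) measurable_const
      exact (hid i).symm.ae_snd hms hZ0
    have h1 : (Set.univ : Set Ω) ≤ᵐ[μ] {ω | opNorm ((1 / (n : ℝ)) • (∑ i, Zs i ω) - S) ≤
              200 * (η * opNorm S * Real.sqrt ((2 * effRank S + t) / n) *
                max 1 (Real.sqrt ((effRank S + t / 2) / n)))} := by
      filter_upwards [hZs0] with ω hω _
      change _ ≤ _
      simp [hω, hS0, opNorm_zero]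
    calc ENNReal.ofReal (1 - Real.exp (-t)) ≤ ENNReal.ofReal 1 :=
          ENNReal.ofReal_le_ofReal (by linarith [Real.exp_pos (-t)])
      _ = μ Set.univ := by simp
      _ ≤ _ := measure_mono_ae h1
  set s := opNorm S with hs_def
  have hs : 0 < s := opNorm_pos hS0
  have htr : s ≤ S.trace := opNorm_le_trace hSp
  have htr0 : 0 < S.trace := hs.trans_le htr
  set r := effRank S with hr_def
  have hr : 1 ≤ r := by rw [hr_def, effRank, one_le_div hs]; exact htr
  set x := (2 * r + t) / n with hx
  set a := min 1 (Real.sqrt x) / 2 with ha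
  have hx0 : 0 < x := by positivity
  have ha0 : 0 < a := by have := Real.sqrt_pos.2 hx0; positivity
  have ha1 : a ≤ 1 / 2 := by
    have : min 1 (Real.sqrt x) ≤ 1 := min_le_left _ _
    linarith
  -- Normalised so that `e · lam · η · 6s = a ≤ 1/2`, the range where the exponential moment bound
  -- holds.
  set lam := a / (6 * Real.exp 1 * η * s) with hlam
  have hlam0 : 0 < lam := by positivity
  have hsc : Real.exp 1 * (lam * η * (6 * s)) = a := by
    rw [hlam]; field_simp
  -- The largest variance with `v * S.trace ≤ s`; it makes `1 / v` equal to `r`.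
  set v : NNReal := ⟨s / S.trace, by positivity⟩ with hv_def
  have hvr : (v : ℝ) = s / S.trace := rfl
  have hv0 : v ≠ 0 := by
    rw [← NNReal.coe_ne_zero, hvr]; positivity
  -- The samples are only almost everywhere measurable; measurable versions allow Tonelli on the
  -- product with the Gaussian.
  set M : Fin n → Ω → Matrix (Fin l) (Fin l) ℝ := fun i => (hZsm i).mk (Zs i) with hM
  have hMm : ∀ i, Measurable (M i) := fun i => (hZsm i).measurable_mk
  have hMe : ∀ i, Zs i =ᵐ[μ] M i := fun i => (hZsm i).ae_eq_mk
  have hMind : iIndepFun M μ := hind.congr hMe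
  have key := pacBayes_bilin (μ := μ) hMm hMind hSp hs hv0
    (by rw [hvr]; exact (div_mul_cancel₀ _ htr0.ne').le) (lam := lam) (b := 2 * a ^ 2)
    (fun i x y hx hy => by
      have h1 := lintegral_exp_bilin_le hZm hZ hη0 hS hmom hlam0.le (K := 6 * s) (by positivity)
        (by rw [hsc]; exact ha1) hx hy
      rw [hsc] at h1
      refine le_trans (le_of_eq ?_) h1
      have hF : Measurable fun A : Matrix (Fin l) (Fin l) ℝ =>
          ENNReal.ofReal (Real.exp (lam * (x ⬝ᵥ (A *ᵥ y) - x ⬝ᵥ (S *ᵥ y)))) := by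
        have := measurable_matrix_bilin x y
        fun_prop
      refine Eq.trans (lintegral_congr_ae ?_) ((hid i).comp hF).lintegral_eq
      filter_upwards [hMe i] with ω hω
      simp [Function.comp, hω]) t
  refine key.trans (measure_mono_ae ?_)
  have hall : ∀ᵐ ω ∂μ, ∀ i, Zs i ω = M i ω := ae_all_iff.2 hMe
  filter_upwards [hall] with ω hω hgood
  change opNorm _ ≤ _
  replace hgood : ∀ u w : Fin l → ℝ, u ⬝ᵥ u = 1 → w ⬝ᵥ w = 1 →
      u ⬝ᵥ (S *ᵥ u) ≤ s → w ⬝ᵥ (S *ᵥ w) ≤ s →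
      lam * (u ⬝ᵥ ((∑ i, M i ω - (n : ℝ) • S) *ᵥ w)) ≤
        n * (2 * a ^ 2) + 2 * Real.log 2 + 1 / v + t := hgood
  refine opNorm_le_of_bilin_le (by positivity) fun u w hu hw => ?_
  have h1 := hgood u w hu hw (quadForm_le_opNorm S hu) (quadForm_le_opNorm S hw)
  have hvr' : 1 / (v : ℝ) = r := by rw [hvr, one_div_div]; rfl
  rw [hvr'] at h1
  have h2 := deviation_le_of_tuned hn hη hs hr ht hx h1
  have h3 : (1 / (n : ℝ)) • (∑ i, Zs i ω) - S =
      (1 / (n : ℝ)) • (∑ i, M i ω - (n : ℝ) • S) := by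
    rw [smul_sub, smul_smul, one_div_mul_cancel hn'.ne', one_smul]
    simp_rw [hω]
  rw [h3, Matrix.smul_mulVec, dotProduct_smul, smul_eq_mul]
  exact h2
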